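/- Let $0\le k\le n$ and $[n]=\{1,\dots,n\}$. **The bridge polytope.** Let $S_{k,n}$ be the set of permutations $\pi\in S_n$ with $\pi(j)\ge j$ for $1\le j\le k$ and $\pi(j)\le j$ for $k<j\le n$, and let $\mathrm{Br}_{k,n}\subset\mathbb R^n$ be the convex hull of the points $(\pi(1),\dots,\pi(n))$, $\pi\in S_{k,n}$. These points are exactly the vertices of $\mathrm{Br}_{k,n}$, and we label each vertex by the corresponding $\pi$. Both $\pi_{k,n}=(n-k+1,n-k+2,\dots,n,1,2,\dots,n-k)$ and the identity $e$ lie in $S_{k,n}$. The one-skeleton of $\mathrm{Br}_{k,n}$ is the graph formed by its vertices and edges (one-dimensional faces). A step along an edge from $\pi$ to $\hat\pi$ is labelled by the permutation $\hat\pi\pi^{-1}$, i.e. by $(i\,\ell)$ if $\pi$ and $\hat\pi$ differ by swapping the values $i$ and $\ell$. **BCFW-bridge decompositions.** A decorated permutation is a permutation $\pi$ of $[n]$ whose fixed points are each coloured clockwise or counterclockwise. Its affinization $\tilde\pi:[n]\to\mathbb Z$ is given by $\tilde\pi(i)=\pi(i)$ if $\pi(i)>i$, or if $i$ is a clockwise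 fixed point, and $\tilde\pi(i)=\pi(i)+n$ if $\pi(i)<i$, or if $i$ is a counterclockwise fixed point. Regard $\pi_{m,n}$, $0\le m\le n$, as a decorated permutation by calling a fixed point counterclockwise if and only if it lies in $\{1,\dots,m\}$ (there are fixed points only if $m\in\{0,n\}$). Position $i$ of a map $f:[n]\to\mathbb Z$ is called fixed if $f(i)\in\{i,i+n\}$. A BCFW-bridge decomposition of a decorated permutation $\pi$ is a finite sequence of transpositions obtained as follows. Start with $f=\tilde\pi$. As long as not all positions of $f$ are fixed, choose positions $i<j$ such that $f(i)<f(j)$, neither $i$ nor $j$ is fixed, and all positions $h$ with $i<h<j$ are fixed; record the transposition $(i\,j)$, and swap the entries of $f$ in positions $i$ and $j$. Stop when all positions of $f$ are fixed. **Claim.** Sending a path to the sequence of its edge labels, in order from its start to its end, is a bijection from the set of shortest paths from $\pi_{k,n}$ to $e$ in the one-skeleton of $\mathrm{Br}_{k,n}$ onto the set of BCFW-bridge decompositions of $\pi_{n-k,n}$. -/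

import Mathlib

/-! The letters `1, …, n` are represented by the elements `0, …, n - 1` of `Fin n`. -/

namespace BridgePolytope

open Equiv

/-! ### Polytopes and their one-skeleta -/

/-- The one-skeleton of a convex polytope `P`: two distinct vertices (extreme points) of `P` are
adjacent iff the segment joining them is a face of `P`, that is, the set of all points of `P` at
which some linear functional attains its maximum over `P`. -/
def oneSkeleton {E : Type*} [AddCommGroup E] [Module ℝ E] [TopologicalSpace E] (P : Set E) :
    SimpleGraph E where
  Adj x y := x ≠ y ∧ x ∈ P.extremePoints ℝ ∧ y ∈ P.extremePoints ℝ ∧ IsExposed ℝ P (segment ℝ x y)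
  symm := ⟨fun x y h => ⟨h.1.symm, h.2.2.1, h.2.1, by rw [segment_symm]; exact h.2.2.2⟩⟩
  loopless := ⟨fun _ h => h.1 rfl⟩

/-! ### The bridge polytope -/

/-- The point `(π(1), …, π(n))` of `ℝⁿ` (in one-line notation with letters `1, …, n`). -/
def permPoint {n : ℕ} (π : Perm (Fin n)) : Fin n → ℝ := fun j => ((π j : ℕ) : ℝ) + 1

/-- `S_J`: the permutations with `π(j) ≥ j` for `j ∈ J` and `π(j) ≤ j` for `j ∉ J`. -/
def excedancePerms {n : ℕ} (J : Set (Fin n)) : Set (Perm (Fin n)) :=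
  {π | (∀ j ∈ J, j ≤ π j) ∧ ∀ j ∉ J, π j ≤ j}

/-- The bridge polytope `Br_J`. -/
def bridgePolytope {n : ℕ} (J : Set (Fin n)) : Set (Fin n → ℝ) :=
  convexHull ℝ (permPoint '' excedancePerms J)

/-- The vertices of `Br_J` are exactly the points `(π(1), …, π(n))` with `π ∈ S_J`. Hence the
vertices may be labelled by the elements of `S_J`. -/
theorem extremePoints_bridgePolytope {n : ℕ} (J : Set (Fin n)) :
    (bridgePolytope J).extremePoints ℝ = permPoint '' excedancePerms J := by
  apply Set.Subset.antisymm extremePoints_convexHull_subset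
  rintro _ ⟨π, hπ, rfl⟩
  have hnorm : ∀ σ : Perm (Fin n), ∑ i, permPoint σ i ^ 2 = ∑ i : Fin n, (((i : ℕ) : ℝ) + 1) ^ 2 :=
    fun σ => Equiv.sum_comp σ (fun i : Fin n => (((i : ℕ) : ℝ) + 1) ^ 2)
  set R := ∑ i : Fin n, (((i : ℕ) : ℝ) + 1) ^ 2 with hR
  have hconv : Convex ℝ {y : Fin n → ℝ | ∑ i, y i ^ 2 ≤ R} := by
    intro x hx y hy a b ha hb hab
    simp only [Set.mem_ofPred_eq] at hx hy ⊢
    have h1 : ∀ i, (a • x + b • y) i ^ 2 ≤ a * x i ^ 2 + b * y i ^ 2 := by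
      intro i
      simp only [Pi.add_apply, Pi.smul_apply, smul_eq_mul]
      obtain rfl : b = 1 - a := by linarith
      nlinarith [mul_nonneg (mul_nonneg ha hb) (sq_nonneg (x i - y i))]
    calc ∑ i, (a • x + b • y) i ^ 2 ≤ ∑ i, (a * x i ^ 2 + b * y i ^ 2) :=
          Finset.sum_le_sum fun i _ => h1 i
      _ = a * ∑ i, x i ^ 2 + b * ∑ i, y i ^ 2 := by
          rw [Finset.sum_add_distrib, Finset.mul_sum, Finset.mul_sum]
      _ ≤ a * R + b * R := by gcongr
      _ = R := by rw [← add_mul, hab, one_mul]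
  have hball : ∀ y ∈ bridgePolytope J, ∑ i, y i ^ 2 ≤ R := by
    intro y hy
    refine convexHull_min ?_ hconv hy
    rintro _ ⟨σ, -, rfl⟩
    exact (hnorm σ).le
  set x := permPoint π with hx
  have key : ∀ y ∈ bridgePolytope J,
      ∑ i, (x i - y i) ^ 2 ≤ 2 * (∑ i, x i * x i - ∑ i, x i * y i) := by
    intro y hy
    have h1 := hball y hy
    have h2 : ∑ i, x i * x i = R := by
      rw [← hnorm π]
      exact Finset.sum_congr rfl fun i _ => (sq (x i)).symm
    have h3 : ∑ i, (x i - y i) ^ 2 = ∑ i, x i * x i - 2 * ∑ i, x i * y i + ∑ i, y i ^ 2 := by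
      rw [Finset.mul_sum, ← Finset.sum_sub_distrib, ← Finset.sum_add_distrib]
      exact Finset.sum_congr rfl fun i _ => by ring
    linarith
  have hmem : x ∈ bridgePolytope J := subset_convexHull ℝ _ ⟨π, hπ, rfl⟩
  apply exposedPoints_subset_extremePoints
  refine ⟨hmem, ∑ i, x i • ContinuousLinearMap.proj i, fun y hy => ?_⟩
  have hl : ∀ z : Fin n → ℝ,
      (∑ i, x i • (ContinuousLinearMap.proj i : (Fin n → ℝ) →L[ℝ] ℝ)) z = ∑ i, x i * z i := by
    intro z
    simp
  rw [hl, hl]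
  have h0 : 0 ≤ ∑ i, (x i - y i) ^ 2 := Finset.sum_nonneg fun i _ => sq_nonneg _
  have hk := key y hy
  refine ⟨by linarith, fun hle => ?_⟩
  have hz : ∑ i, (x i - y i) ^ 2 = 0 := le_antisymm (by linarith) h0
  funext i
  have := (Finset.sum_eq_zero_iff_of_nonneg fun i _ => sq_nonneg (x i - y i)).1 hz i
    (Finset.mem_univ i)
  have := pow_eq_zero_iff (two_ne_zero) |>.1 this
  linarith

/-- The one-skeleton of `Br_J`, with every vertex `(π(1), …, π(n))` labelled by `π ∈ S_J`. -/
def bridgeGraph {n : ℕ} (J : Set (Fin n)) : SimpleGraph (excedancePerms J) :=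
  (oneSkeleton (bridgePolytope J)).comap fun π => permPoint π.1

/-- The edge labels along a path in the one-skeleton of `Br_J`: the label of the step from `π` to
`π'` is the `τ` with `τ π = π'`, so it is `(i ℓ)` when `π` and `π'` differ by swapping the
values `i` and `ℓ`. -/
def edgeLabels {n : ℕ} {J : Set (Fin n)} {u v : excedancePerms J} (p : (bridgeGraph J).Walk u v) :
    List (Perm (Fin n)) :=
  p.darts.map fun d => d.snd.1 * d.fst.1⁻¹

/-- A path is shortest if no path with the same endpoints has fewer edges. -/
def IsShortest {V : Type*} {G : SimpleGraph V} {u v : V} (p : G.Walk u v) : Prop :=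
  ∀ q : G.Walk u v, p.length ≤ q.length

/-! ### The permutation `π_{k,n}` -/

/-- `π_{k,n} = (n-k+1, n-k+2, …, n, 1, 2, …, n-k)` as an ordinary permutation. -/
def topPerm (k n : ℕ) (hk : k ≤ n) : Perm (Fin n) where
  toFun i := if h : i.1 < k then ⟨i.1 + (n - k), by omega⟩ else ⟨i.1 - k, by omega⟩
  invFun i := if h : i.1 < n - k then ⟨i.1 + k, by omega⟩ else ⟨i.1 - (n - k), by omega⟩
  left_inv i := by
    apply Fin.ext
    by_cases h : i.1 < k
    · simp [h]
    · have h' : i.1 - k < n - k := by omega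
      simp [h, h']
      omega
  right_inv i := by
    apply Fin.ext
    by_cases h : i.1 < n - k
    · simp [h]
    · have h' : i.1 - (n - k) < k := by omega
      simp [h, h']
      omega

/-- The set `{1, …, k}` of letters. -/
def firstLetters (k n : ℕ) : Set (Fin n) := {j | j.1 < k}

theorem topPerm_mem (k n : ℕ) (hk : k ≤ n) : topPerm k n hk ∈ excedancePerms (firstLetters k n) := by
  constructor <;> intro j hj <;> simp only [firstLetters, Set.mem_ofPred_eq] at hj <;>
    simp [topPerm, hj, Fin.le_def]

theorem one_mem {n : ℕ} (J : Set (Fin n)) : (1 : Perm (Fin n)) ∈ excedancePerms J :=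
  ⟨fun _ _ => le_rfl, fun _ _ => le_rfl⟩

/-- The vertex of `Br_{k,n} = Br_{{1, …, k}}` labelled by `π_{k,n}`. -/
def topVertex (k n : ℕ) (hk : k ≤ n) : excedancePerms (firstLetters k n) :=
  ⟨topPerm k n hk, topPerm_mem k n hk⟩

/-- The vertex of `Br_J` labelled by the identity permutation. -/
def idVertex {n : ℕ} (J : Set (Fin n)) : excedancePerms J := ⟨1, one_mem J⟩

/-! ### Decorated permutations and BCFW-bridge decompositions -/

/-- A decorated permutation: a permutation whose fixed points are coloured counterclockwise
(those in `ccw`) or clockwise (the other fixed points). -/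
structure DecoratedPerm (n : ℕ) where
  perm : Perm (Fin n)
  ccw : Finset (Fin n)
  ccw_fixed : ∀ i ∈ ccw, perm i = i

/-- The affinization of a decorated permutation. As positions and values are both counted from `0`,
it satisfies `i ≤ π̃(i) ≤ i + n` as usual. -/
def DecoratedPerm.affinization {n : ℕ} (π : DecoratedPerm n) (i : Fin n) : ℕ :=
  if π.perm i < i then (π.perm i).1 + n
  else if π.perm i = i then (if i ∈ π.ccw then i.1 + n else i.1)
  else (π.perm i).1

/-- `π_{k,n}` as a decorated permutation: a fixed point is counterclockwise iff its position is one
of the first `k` (there are fixed points only if `k = 0` or `k = n`). -/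
def topDecorated (k n : ℕ) (hk : k ≤ n) : DecoratedPerm n where
  perm := topPerm k n hk
  ccw := Finset.univ.filter fun i => topPerm k n hk i = i ∧ i.1 < k
  ccw_fixed _ hi := (Finset.mem_filter.1 hi).2.1

/-- Position `i` is a fixed point of the affine permutation `f`. -/
def IsFixedPos {n : ℕ} (f : Fin n → ℕ) (i : Fin n) : Prop := f i = i.1 ∨ f i = i.1 + n

/-- The pairs of positions that the BCFW-bridge construction may choose: `i < j` with
`f(i) < f(j)`, neither position is a fixed point, and every position strictly between is. -/
def IsBridge {n : ℕ} (f : Fin n → ℕ) (i j : Fin n) : Prop :=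
  i < j ∧ f i < f j ∧ ¬ IsFixedPos f i ∧ ¬ IsFixedPos f j ∧ ∀ h, i < h → h < j → IsFixedPos f h

/-- `BridgeSequence f L`: starting from the affine permutation `f`, the BCFW-bridge construction
can record the list `L` of transpositions and end at a decoration of the identity. -/
inductive BridgeSequence {n : ℕ} : (Fin n → ℕ) → List (Perm (Fin n)) → Prop
  | nil (f : Fin n → ℕ) (hf : ∀ i, IsFixedPos f i) : BridgeSequence f []
  | cons (f : Fin n → ℕ) (i j : Fin n) (L : List (Perm (Fin n))) (hij : IsBridge f i j)
      (hL : BridgeSequence (f ∘ swap i j) L) : BridgeSequence f (swap i j :: L)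

/-- The BCFW-bridge decompositions of a decorated permutation, as sequences of transpositions in the
order in which they are recorded. -/
def bcfwDecompositions {n : ℕ} (π : DecoratedPerm n) : Set (List (Perm (Fin n))) :=
  {L | BridgeSequence π.affinization L}

end BridgePolytope

namespace BridgePolytope

open Equiv

/-! ### Linear functionals on permutations -/

/-! Two facts carry the proof: a description of the edges of `Br_J`, and a rank function on the
vertices of `Br_{k,n}`.

Edges. For a vertex `π`, write any other vertex as `σ = τ π`. A linear functional with coefficients
`C` at positions becomes a weight `c v = C (π⁻¹ v)` on values, and comparing it at `σ` and `π` means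
comparing `∑ c v * τ v` with `∑ c v * v`. `sum_mul_perm_le` bounds the difference by a flow
argument, and only pairs of a rising and a falling value matter. Monotonicity on these pairs follows
from the admissible transpositions whose intermediate values are all fixed (`lt_of_forall_swap_lt`),
so no other direction at `π` can be an edge. An explicit weight with a single tie shows that these
directions are edges. This gives `bridgeGraph_adj_iff`.

Rank. Multiplying `π` on the left by `(a b)` swaps the positions `a` and `b` of `f = invAffinization
k π`, which is how a bridge acts. Along an edge the number of inversions of `f` changes by exactly
one, and the edges that raise it are exactly the bridges (`isBridge_invAffinization_iff`). A vertex
other than the identity always admits a bridge (`exists_isBridge`), so a rank-increasing path leads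
from every vertex to the identity. Hence a path to the identity is shortest iff each of its steps
raises the rank, that is, iff its labels form a bridge sequence. Labels determine the path, and at
`π_{k,n}` the function `f` is the affinization of `π_{n-k,n}`, up to the colours of fixed points in
the degenerate cases. -/

theorem exists_separating_of_forall_le {ι : Type*} (c : ι → ℝ) (A B : Finset ι)
    (h : ∀ a ∈ A, ∀ b ∈ B, c a ≤ c b) : ∃ θ, (∀ a ∈ A, c a ≤ θ) ∧ ∀ b ∈ B, θ ≤ c b := by
  rcases A.eq_empty_or_nonempty with rfl | hA
  · rcases B.eq_empty_or_nonempty with rfl | hB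
    · exact ⟨0, by simp, by simp⟩
    · exact ⟨B.inf' hB c, by simp, fun b hb => Finset.inf'_le c hb⟩
  · exact ⟨A.sup' hA c, fun a ha => Finset.le_sup' c ha,
      fun b hb => Finset.sup'_le hA c fun a ha => h a ha b hb⟩

/-- Writing `v` as the number of `t < v` splits the difference of the two sums over thresholds `t`.
As many values cross `t` upwards as downwards, so subtracting a constant `θ t` from `c` changes
nothing. Choosing `θ t` between the weights of the upward and the downward crossers makes every term
nonpositive, and equality forces all crossers of `t` to have weight `θ t`. -/
theorem sum_mul_perm_le {n : ℕ} (τ : Perm (Fin n)) (c : Fin n → ℝ)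
    (h : ∀ a b : Fin n, a < b → a < τ a → τ b < b → c a ≤ c b) :
    ∑ v, c v * ((τ v : ℕ) : ℝ) ≤ ∑ v, c v * ((v : ℕ) : ℝ) ∧
      (∑ v, c v * ((τ v : ℕ) : ℝ) = ∑ v, c v * ((v : ℕ) : ℝ) →
        ∀ a b t : Fin n, a ≤ t → t < τ a → τ b ≤ t → t < b → c a = c b) := by
  classical
  have hθ : ∀ t : Fin n, ∃ θ : ℝ, (∀ a, a ≤ t → t < τ a → c a ≤ θ) ∧
      ∀ b, τ b ≤ t → t < b → θ ≤ c b := by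
    intro t
    obtain ⟨θ, h1, h2⟩ := exists_separating_of_forall_le c
      (Finset.univ.filter fun a => a ≤ t ∧ t < τ a) (Finset.univ.filter fun b => τ b ≤ t ∧ t < b)
      (by
        intro a ha b hb
        simp only [Finset.mem_filter, Finset.mem_univ, true_and] at ha hb
        exact h a b (ha.1.trans_lt hb.2) (ha.1.trans_lt ha.2) (hb.1.trans_lt hb.2))
    exact ⟨θ, fun a h3 h4 => h1 a (by simp [h3, h4]), fun b h3 h4 => h2 b (by simp [h3, h4])⟩
  choose θ hA hB using hθ
  -- `D t v` is `1` if `v` crosses `t` upwards under `τ`, `-1` if downwards, and `0` otherwise.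
  let D : Fin n → Fin n → ℝ := fun t v => (if t < τ v then 1 else 0) - (if t < v then 1 else 0)
  have hcount : ∀ v : Fin n, ((v : ℕ) : ℝ) = ∑ t : Fin n, if t < v then (1 : ℝ) else 0 := by
    intro v
    rw [Finset.sum_boole]
    congr 1
    rw [← Fin.card_Iio v]
    congr 1
    ext; simp
  have hD0 : ∀ t, ∑ v, D t v = 0 := by
    intro t
    simp only [D, Finset.sum_sub_distrib]
    rw [Equiv.sum_comp τ (fun v => if t < v then (1 : ℝ) else 0), sub_self]
  have hterm : ∀ t v, (c v - θ t) * D t v ≤ 0 := by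
    intro t v
    by_cases h1 : t < τ v <;> by_cases h2 : t < v <;> simp only [D, h1, h2, if_true, if_false]
    · simp
    · linarith [hA t v (not_lt.1 h2) h1]
    · linarith [hB t v (not_lt.1 h1) h2]
    · simp
  have hsum : ∑ v, c v * ((τ v : ℕ) : ℝ) - ∑ v, c v * ((v : ℕ) : ℝ) =
      ∑ t, ∑ v, (c v - θ t) * D t v := by
    have h1 : ∀ t, ∑ v, (c v - θ t) * D t v = ∑ v, c v * D t v := by
      intro t
      simp only [sub_mul, Finset.sum_sub_distrib]
      rw [← Finset.mul_sum, hD0, mul_zero, sub_zero]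
    simp only [h1]
    rw [Finset.sum_comm, ← Finset.sum_sub_distrib]
    refine Finset.sum_congr rfl fun v _ => ?_
    rw [← Finset.mul_sum, hcount (τ v), hcount v, ← mul_sub, ← Finset.sum_sub_distrib]
  have hrow : ∀ t ∈ Finset.univ, ∑ v, (c v - θ t) * D t v ≤ 0 := fun t _ =>
    Finset.sum_nonpos fun v _ => hterm t v
  have hle := Finset.sum_nonpos hrow
  refine ⟨by linarith, fun heq a b t ha1 ha2 hb1 hb2 => ?_⟩
  have h0 : ∑ t, ∑ v, (c v - θ t) * D t v = 0 := by linarith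
  have h1 := (Finset.sum_eq_zero_iff_of_nonpos hrow).1 h0 t (Finset.mem_univ t)
  have h2 := (Finset.sum_eq_zero_iff_of_nonpos fun v _ => hterm t v).1 h1
  have h3 := h2 a (Finset.mem_univ a)
  have h4 := h2 b (Finset.mem_univ b)
  simp only [D, ha2, hb2, not_lt.2 ha1, not_lt.2 hb1, if_true, if_false] at h3 h4
  linarith

theorem exists_crossing {n : ℕ} (τ : Perm (Fin n)) (t : Fin n) (h : ∃ a, a ≤ t ∧ t < τ a) :
    ∃ b, τ b ≤ t ∧ t < b := by
  by_contra! hb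
  obtain ⟨a, ha, ha'⟩ := h
  have h1 : (Finset.Iic t).map τ.symm.toEmbedding ⊆ Finset.Iic t := by
    intro x hx
    simp only [Finset.mem_map_equiv, Equiv.symm_symm, Finset.mem_Iic] at hx ⊢
    exact hb x hx
  have h2 := Finset.eq_of_subset_of_card_le h1 (by simp)
  have h3 := Finset.mem_Iic.2 ha
  rw [← h2] at h3
  simp only [Finset.mem_map_equiv, Equiv.symm_symm, Finset.mem_Iic] at h3
  exact absurd ha' (not_lt.2 h3)

theorem exists_lt_apply_of_ne_one {n : ℕ} {τ : Perm (Fin n)} (h : τ ≠ 1) : ∃ a, a < τ a := by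
  by_contra! hle
  apply h
  ext1 x
  induction x using WellFoundedLT.induction with
  | _ x ih =>
    rcases (hle x).lt_or_eq with hx | hx
    · exact absurd (τ.injective (ih _ hx)) hx.ne
    · exact hx

/-! ### Transpositions in `S_J` -/

/-- Only the positions of `a` and `b` are affected. The one holding `b` could violate its condition
after the swap only if it lay in `J` and in `(a, b]`; but positions strictly between hold their own
values, and `b` itself is excluded by `hb`. The position holding `a` is symmetric. -/
theorem swap_mul_mem {n : ℕ} {J : Set (Fin n)} {π : Perm (Fin n)} (hπ : π ∈ excedancePerms J)
    {a b : Fin n} (hab : a < b) (hfix : ∀ h, a < h → h < b → π h = h)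
    (ha : π a = a → a ∈ J) (hb : π b = b → b ∉ J) : swap a b * π ∈ excedancePerms J := by
  constructor <;> intro j hj <;> rw [Perm.mul_apply, swap_apply_def] <;> split_ifs with h1 h2
  · exact (h1 ▸ hπ.1 j hj).trans hab.le
  · have h3 : j ≤ b := h2 ▸ hπ.1 j hj
    by_contra h4
    rcases h3.lt_or_eq with h5 | rfl
    · have := hfix j (not_le.1 h4) h5
      exact h5.ne (this.symm.trans h2)
    · exact hb h2 hj
  · exact hπ.1 j hj
  · have h3 : a ≤ j := h1 ▸ hπ.2 j hj
    by_contra h4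
    rcases h3.lt_or_eq with h5 | rfl
    · have := hfix j h5 (not_le.1 h4)
      exact h5.ne' (this.symm.trans h1)
    · exact hj (ha h1)
  · exact hab.le.trans (h2 ▸ hπ.2 j hj)
  · exact hπ.2 j hj

/-- If one of `a`, `b` is a fixed point of `π`, the swap moves it away, and the other value cannot
land on its own position either. So each edge has an endpoint at which neither swapped value is
fixed, as `isExposed_segment_swap` requires. -/
theorem swap_mem_not_fixed {n : ℕ} {J : Set (Fin n)} {π : Perm (Fin n)}
    (hπ : π ∈ excedancePerms J) {a b : Fin n} (hab : a < b)
    (hs : swap a b * π ∈ excedancePerms J) :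
    (π a ≠ a ∧ π b ≠ b) ∨ ((swap a b * π) a ≠ a ∧ (swap a b * π) b ≠ b) := by
  have hp : π (π⁻¹ a) = a := by simp
  have hq : π (π⁻¹ b) = b := by simp
  have e1 : π a = a ↔ π⁻¹ a = a := by rw [Perm.inv_eq_iff_eq, eq_comm]
  have e2 : π b = b ↔ π⁻¹ b = b := by rw [Perm.inv_eq_iff_eq, eq_comm]
  have e3 : (swap a b * π) a = a ↔ π⁻¹ b = a := by
    rw [Perm.mul_apply, swap_apply_eq_iff, swap_apply_left, Perm.inv_eq_iff_eq, eq_comm]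
  have e4 : (swap a b * π) b = b ↔ π⁻¹ a = b := by
    rw [Perm.mul_apply, swap_apply_eq_iff, swap_apply_right, Perm.inv_eq_iff_eq, eq_comm]
  have hpq : π⁻¹ a ≠ π⁻¹ b := fun h => hab.ne (π⁻¹.injective h)
  rw [ne_eq, ne_eq, ne_eq, ne_eq, e1, e2, e3, e4]
  have a1 := hπ.1 (π⁻¹ a)
  have a2 := hπ.2 (π⁻¹ b)
  have a3 := hs.1 (π⁻¹ b)
  have a4 := hs.2 (π⁻¹ a)
  rw [Perm.mul_apply, hp, swap_apply_left] at a4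
  rw [Perm.mul_apply, hq, swap_apply_right] at a3
  rw [hp] at a1
  rw [hq] at a2
  by_cases hpJ : π⁻¹ a ∈ J <;> by_cases hqJ : π⁻¹ b ∈ J <;>
    simp only [hpJ, hqJ, true_implies, not_true_eq_false, not_false_eq_true, false_implies] at a1 a2 a3 a4 <;>
    omega

/-! ### Edges of the bridge polytope -/

theorem permPoint_injective {n : ℕ} : Function.Injective (permPoint (n := n)) := by
  intro π σ h
  ext j
  have := congrFun h j
  simpa [permPoint] using this

theorem isExposed_segment_convexHull {E : Type*} [AddCommGroup E] [Module ℝ E] [TopologicalSpace E]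
    {V : Set E} {x y : E} (hx : x ∈ V) (hy : y ∈ V) (l : StrongDual ℝ E) (hxy : l x = l y)
    (hV : ∀ z ∈ V, l z ≤ l x) (heq : ∀ z ∈ V, l z = l x → z = x ∨ z = y) :
    IsExposed ℝ (convexHull ℝ V) (segment ℝ x y) := by
  have hseg : ∀ z ∈ segment ℝ x y, l z = l x := by
    rintro z ⟨a, b, -, -, hab, rfl⟩
    simp only [map_add, map_smul, smul_eq_mul, ← hxy, ← add_mul, hab, one_mul]
  have hconv : Convex ℝ {z | l z < l x ∨ z ∈ segment ℝ x y} := by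
    intro z hz w hw a b ha hb hab
    rcases ha.eq_or_lt with rfl | ha'
    · obtain rfl : b = 1 := by linarith
      simpa using hw
    rcases hb.eq_or_lt with rfl | hb'
    · obtain rfl : a = 1 := by linarith
      simpa using hz
    obtain rfl : b = 1 - a := by linarith
    rcases hz with hz | hz
    · left
      have hw' : l w ≤ l x := hw.elim le_of_lt fun h => (hseg w h).le
      simp only [map_add, map_smul, smul_eq_mul]
      nlinarith
    · rcases hw with hw | hw
      · left
        simp only [map_add, map_smul, smul_eq_mul, hseg z hz]
        nlinarith
      · exact Or.inr (convex_segment x y hz hw ha hb hab)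
  have hsub : convexHull ℝ V ⊆ {z | l z < l x ∨ z ∈ segment ℝ x y} := by
    refine convexHull_min (fun z hz => ?_) hconv
    rcases (hV z hz).lt_or_eq with h | h
    · exact Or.inl h
    · rcases heq z hz h with rfl | rfl
      · exact Or.inr (left_mem_segment ℝ _ _)
      · exact Or.inr (right_mem_segment ℝ _ _)
  have hx' : x ∈ convexHull ℝ V := subset_convexHull ℝ V hx
  have hy' : y ∈ convexHull ℝ V := subset_convexHull ℝ V hy
  intro _
  refine ⟨l, ?_⟩
  ext z
  constructor
  · intro hz
    refine ⟨(convex_convexHull ℝ V).segment_subset hx' hy' hz, fun w hw => ?_⟩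
    rw [hseg z hz]
    exact (hsub hw).elim le_of_lt fun h => (hseg w h).le
  · rintro ⟨hz, hmax⟩
    exact (hsub hz).resolve_left (not_lt.2 (hmax x hx'))

theorem eq_or_eq_of_mem_segment {E : Type*} [AddCommGroup E] [Module ℝ E] {P : Set E} {x y z : E}
    (hz : z ∈ P.extremePoints ℝ) (hx : x ∈ P) (hy : y ∈ P) (h : z ∈ segment ℝ x y) :
    z = x ∨ z = y := by
  rcases ((mem_extremePoints_iff_forall_segment).1 hz).2 x hx y hy h with h | h
  · exact Or.inl h.symm
  · exact Or.inr h.symm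

theorem sum_permPoint_mul {n : ℕ} (π σ : Perm (Fin n)) (C : Fin n → ℝ) :
    ∑ p, permPoint σ p * C p =
      ∑ v, C (π⁻¹ v) * (((σ * π⁻¹) v : ℕ) : ℝ) + ∑ p, C p := by
  have h := Equiv.sum_comp π⁻¹ (fun p => C p * ((σ p : ℕ) : ℝ))
  simp only [Perm.mul_apply]
  rw [h, ← Finset.sum_add_distrib]
  exact Finset.sum_congr rfl fun p _ => by simp only [permPoint]; ring

/-- A value strictly between `a` and `b` that is not fixed satisfies both side conditions vacuously,
so the interval can be cut there and the inequalities chained. -/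
theorem lt_of_forall_swap_lt {n : ℕ} {J : Set (Fin n)} {π : Perm (Fin n)}
    (hπ : π ∈ excedancePerms J) (c : Fin n → ℝ)
    (h : ∀ a b, a < b → (∀ h, a < h → h < b → π h = h) → swap a b * π ∈ excedancePerms J →
      c a < c b) (a b : Fin n) (hab : a < b) (ha : π a = a → a ∈ J) (hb : π b = b → b ∉ J) :
    c a < c b := by
  by_cases hfix : ∀ h, a < h → h < b → π h = h
  · exact h a b hab hfix (swap_mul_mem hπ hab hfix ha hb)
  · push Not at hfix
    obtain ⟨x, hax, hxb, hx⟩ := hfix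
    exact (lt_of_forall_swap_lt hπ c h a x hax ha fun e => absurd e hx).trans
      (lt_of_forall_swap_lt hπ c h x b hxb (fun e => absurd e hx) hb)
termination_by b.1 - a.1

theorem mem_of_lt_apply {n : ℕ} {J : Set (Fin n)} {π σ : Perm (Fin n)}
    (hσ : σ ∈ excedancePerms J) {a : Fin n} (ha : a < (σ * π⁻¹) a) (hfix : π a = a) : a ∈ J := by
  by_contra hJ
  have e : π⁻¹ a = a := Perm.inv_eq_iff_eq.2 hfix.symm
  rw [Perm.mul_apply, e] at ha
  exact absurd (hσ.2 a hJ) (not_le.2 ha)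

theorem notMem_of_apply_lt {n : ℕ} {J : Set (Fin n)} {π σ : Perm (Fin n)}
    (hσ : σ ∈ excedancePerms J) {a : Fin n} (ha : (σ * π⁻¹) a < a) (hfix : π a = a) : a ∉ J := by
  intro hJ
  have e : π⁻¹ a = a := Perm.inv_eq_iff_eq.2 hfix.symm
  rw [Perm.mul_apply, e] at ha
  exact absurd (hσ.1 a hJ) (not_le.2 ha)

/-- A value that moves crosses some threshold, and by counting some value crosses it the other way.
Hence only `i` moves up and only `l` moves down. -/
theorem eq_swap_of_crossing {n : ℕ} {τ : Perm (Fin n)} {i l : Fin n} (hτ : τ ≠ 1)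
    (h : ∀ a b t : Fin n, a ≤ t → t < τ a → τ b ≤ t → t < b → a = i ∧ b = l) : τ = swap i l := by
  have hfix : ∀ v, v ≠ i → v ≠ l → τ v = v := by
    intro v hi hl
    rcases lt_trichotomy v (τ v) with hv | hv | hv
    · obtain ⟨b, hb, hb'⟩ := exists_crossing τ v ⟨v, le_rfl, hv⟩
      exact absurd (h v b v le_rfl hv hb hb').1 hi
    · exact hv.symm
    · obtain ⟨b, hb, hb'⟩ := exists_crossing τ⁻¹ (τ v) ⟨τ v, le_rfl, by simpa using hv⟩
      exact absurd (h (τ⁻¹ b) v (τ v) hb (by simpa using hb') le_rfl hv).2 hl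
  obtain ⟨a, ha⟩ := exists_lt_apply_of_ne_one hτ
  obtain ⟨b, hb, hb'⟩ := exists_crossing τ a ⟨a, le_rfl, ha⟩
  obtain ⟨rfl, rfl⟩ := h a b a le_rfl ha hb hb'
  have h1 : τ a = b := by
    by_contra hne
    exact ha.ne' (τ.injective (hfix (τ a) ha.ne' hne))
  have h2 : τ b = a := by
    by_contra hne
    have hne' : τ b ≠ b := (hb.trans_lt hb').ne
    exact hne' (τ.injective (hfix (τ b) hne hne'))
  ext1 v
  rw [swap_apply_def]
  split_ifs with e1 e2
  · rw [e1, h1]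
  · rw [e2, h2]
  · exact hfix v e1 e2

theorem sum_permPoint_swap {n : ℕ} (π : Perm (Fin n)) (a b : Fin n) (hab : a ≠ b) (C : Fin n → ℝ) :
    ∑ p, permPoint (swap a b * π) p * C p =
      ∑ p, permPoint π p * C p +
        (((b : ℕ) : ℝ) - ((a : ℕ) : ℝ)) * (C (π⁻¹ a) - C (π⁻¹ b)) := by
  rw [sum_permPoint_mul π, sum_permPoint_mul π π, mul_inv_cancel, mul_inv_cancel_right,
    add_right_comm]
  congr 1
  rw [← sub_eq_iff_eq_add', ← Finset.sum_sub_distrib,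
    Finset.sum_eq_add a b hab (fun v _ hv => ?_) (by simp) (by simp)]
  · rw [swap_apply_left, swap_apply_right, Perm.one_apply, Perm.one_apply]; ring
  · rw [swap_apply_of_ne_of_ne hv.1 hv.2, Perm.one_apply, sub_self]

theorem isExposed_segment_swap {n : ℕ} {J : Set (Fin n)} {π : Perm (Fin n)}
    (hπ : π ∈ excedancePerms J) {a b : Fin n} (hab : a < b)
    (hfix : ∀ h, a < h → h < b → π h = h) (ha : π a ≠ a) (hb : π b ≠ b) :
    IsExposed ℝ (bridgePolytope J) (segment ℝ (permPoint π) (permPoint (swap a b * π))) := by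
  classical
  have hs : swap a b * π ∈ excedancePerms J :=
    swap_mul_mem hπ hab hfix (fun h => absurd h ha) fun h => absurd h hb
  -- The identity weight with `b` lowered to `a`, so that `a` and `b` tie; no non-fixed value lies
  -- between them to break monotonicity. A fixed value can only rise if it is in `J` and only fall
  -- if it is not; the weights `-1` and `n` lie outside the range `0, …, n - 1` and make every pair
  -- involving it strict.
  let c : Fin n → ℝ := fun v =>
    if π v = v then (if v ∈ J then -1 else n) else if v = b then (a : ℕ) else (v : ℕ)
  have hn : ∀ v : Fin n, ((v : ℕ) : ℝ) < n := fun v => by exact_mod_cast v.2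
  have hv0 : ∀ v : Fin n, (0 : ℝ) ≤ ((v : ℕ) : ℝ) := fun v => Nat.cast_nonneg _
  have hlt : ∀ {v w : Fin n}, v < w → ((v : ℕ) : ℝ) < ((w : ℕ) : ℝ) := fun h => by
    exact_mod_cast h
  have hle : ∀ {v w : Fin n}, v ≤ w → ((v : ℕ) : ℝ) ≤ ((w : ℕ) : ℝ) := fun h => by
    exact_mod_cast h
  have hc : ∀ x y : Fin n, x < y → (π x = x → x ∈ J) → (π y = y → y ∉ J) →
      c x < c y ∨ c x = c y ∧ x = a ∧ y = b := by
    intro x y hxy hx hy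
    by_cases hx' : π x = x <;> by_cases hy' : π y = y
    · left
      simp only [c, hx', hx hx', hy', hy hy', if_true, if_false]
      linarith [hv0 x, hn x]
    · left
      simp only [c, hx', hx hx', hy', if_true, if_false]
      split_ifs <;> linarith [hv0 a, hv0 y]
    · left
      simp only [c, hx', hy', hy hy', if_true, if_false]
      split_ifs <;> linarith [hn a, hn x]
    · simp only [c, hx', hy', if_false]
      by_cases hxb : x = b
      · left
        subst hxb
        rw [if_pos rfl, if_neg hxy.ne']
        exact hlt (hab.trans hxy)
      · rw [if_neg hxb]
        by_cases hyb : y = b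
        · subst hyb
          rw [if_pos rfl]
          rcases lt_trichotomy x a with h | h | h
          · exact Or.inl (hlt h)
          · exact Or.inr ⟨by rw [h], h, rfl⟩
          · exact absurd (hfix x h hxy) hx'
        · rw [if_neg hyb]
          exact Or.inl (hlt hxy)
  let C : Fin n → ℝ := fun p => c (π p)
  have hCc : ∀ v, C (π⁻¹ v) = c v := fun v => by simp [C]
  have hcross : ∀ σ ∈ excedancePerms J, ∀ x y, x < y → x < (σ * π⁻¹) x → (σ * π⁻¹) y < y →
      c x < c y ∨ c x = c y ∧ x = a ∧ y = b := fun σ hσ x y hxy hx hy =>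
    hc x y hxy (mem_of_lt_apply hσ hx) (notMem_of_apply_lt hσ hy)
  have hflow : ∀ σ ∈ excedancePerms J, _ := fun σ hσ =>
    sum_mul_perm_le (σ * π⁻¹) c fun x y hxy hx hy =>
      (hcross σ hσ x y hxy hx hy).elim le_of_lt fun h => h.1.le
  let l : StrongDual ℝ (Fin n → ℝ) := ∑ p, C p • ContinuousLinearMap.proj p
  have hl : ∀ σ : Perm (Fin n), l (permPoint σ) = ∑ p, permPoint σ p * C p := by
    intro σ
    simp [l, mul_comm]
  refine isExposed_segment_convexHull ⟨π, hπ, rfl⟩ ⟨_, hs, rfl⟩ l ?_ ?_ ?_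
  · rw [hl, hl, sum_permPoint_swap π a b hab.ne, hCc, hCc]
    have : c a = c b := by simp only [c, ha, hb, hab.ne, if_true, if_false]
    rw [this, sub_self, mul_zero, add_zero]
  · rintro _ ⟨σ, hσ, rfl⟩
    rw [hl, hl, sum_permPoint_mul π, sum_permPoint_mul π π, mul_inv_cancel]
    simp only [hCc]
    exact add_le_add_left (hflow σ hσ).1 _
  · rintro _ ⟨σ, hσ, rfl⟩ heq
    rw [hl, hl, sum_permPoint_mul π, sum_permPoint_mul π π, mul_inv_cancel] at heq
    simp only [hCc] at heq
    have hcr := (hflow σ hσ).2 (add_right_cancel heq)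
    by_cases hτ : σ * π⁻¹ = 1
    · left; rw [mul_inv_eq_one.1 hτ]
    · right
      rw [← eq_swap_of_crossing hτ (i := a) (l := b), inv_mul_cancel_right]
      intro x y t h1 h2 h3 h4
      rcases hcross σ hσ x y (h1.trans_lt h4) (h1.trans_lt h2) (h3.trans_lt h4) with h | h
      · exact absurd (hcr x y t h1 h2 h3 h4) h.ne
      · exact h.2

/-- The edges of `Br_J` swap two values between which every value is a fixed point. -/
theorem bridgeGraph_adj_iff {n : ℕ} {J : Set (Fin n)} (u v : excedancePerms J) :
    (bridgeGraph J).Adj u v ↔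
      ∃ a b, a < b ∧ v.1 = swap a b * u.1 ∧ ∀ h, a < h → h < b → u.1 h = h := by
  obtain ⟨π, hπ⟩ := u
  obtain ⟨σ, hσ⟩ := v
  have hmem : ∀ σ ∈ excedancePerms J, permPoint σ ∈ (bridgePolytope J).extremePoints ℝ :=
    fun σ hσ => extremePoints_bridgePolytope J ▸ ⟨σ, hσ, rfl⟩
  have hmem' : ∀ σ ∈ excedancePerms J, permPoint σ ∈ bridgePolytope J :=
    fun σ hσ => (hmem σ hσ).1
  constructor
  · rintro ⟨hne, -, -, hexp⟩
    dsimp only at hne hexp ⊢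
    obtain ⟨l, hl⟩ := hexp ⟨_, left_mem_segment ℝ _ _⟩
    let C : Fin n → ℝ := fun p => l (Pi.single p 1)
    have hlC : ∀ x : Fin n → ℝ, l x = ∑ p, x p * C p := by
      intro x
      conv_lhs => rw [← Finset.univ_sum_single x]
      rw [map_sum]
      refine Finset.sum_congr rfl fun p _ => ?_
      rw [← smul_eq_mul, ← map_smul, ← Pi.single_smul, smul_eq_mul, mul_one]
    have hπs : permPoint π ∈ segment ℝ (permPoint π) (permPoint σ) := left_mem_segment ℝ _ _
    have hσs : permPoint σ ∈ segment ℝ (permPoint π) (permPoint σ) := right_mem_segment ℝ _ _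
    rw [hl] at hπs hσs
    have hmax : ∀ ρ ∈ excedancePerms J, ρ ≠ π → ρ ≠ σ → l (permPoint ρ) < l (permPoint π) := by
      intro ρ hρ h1 h2
      refine lt_of_le_of_ne (hπs.2 _ (hmem' ρ hρ)) fun heq => ?_
      have : permPoint ρ ∈ segment ℝ (permPoint π) (permPoint σ) := by
        rw [hl]
        exact ⟨hmem' ρ hρ, fun y hy => heq ▸ hπs.2 y hy⟩
      rcases eq_or_eq_of_mem_segment (hmem ρ hρ) (hmem' π hπ) (hmem' σ hσ) this with h | h
      · exact h1 (permPoint_injective h)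
      · exact h2 (permPoint_injective h)
    -- If `σ` is not reached by such a swap, every admissible swap at `π` strictly decreases `l`.
    -- Then the weight is strictly increasing on all relevant pairs, contradicting the tie that `l
    -- (permPoint σ) = l (permPoint π)` forces.
    by_contra! hno
    have hc := lt_of_forall_swap_lt hπ (fun v => C (π⁻¹ v)) (by
      intro a b hab hfix hs
      have h1 : swap a b * π ≠ π := by simpa using hab.ne
      have h2 : swap a b * π ≠ σ := by
        rintro rfl
        obtain ⟨h, h1, h2, h3⟩ := hno a b hab rfl
        exact h3 (hfix h h1 h2)
      have h3 := hmax _ hs h1 h2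
      rw [hlC, hlC, sum_permPoint_swap π a b hab.ne] at h3
      have h4 : ((a : ℕ) : ℝ) < ((b : ℕ) : ℝ) := by exact_mod_cast hab
      by_contra! h5
      nlinarith [mul_nonneg (sub_nonneg.2 h4.le) (sub_nonneg.2 h5)])
    have hcross : ∀ x y, x < y → x < (σ * π⁻¹) x → (σ * π⁻¹) y < y → C (π⁻¹ x) < C (π⁻¹ y) :=
      fun x y hxy hx hy => hc x y hxy (mem_of_lt_apply hσ hx) (notMem_of_apply_lt hσ hy)
    have hflow := (sum_mul_perm_le (σ * π⁻¹) (fun v => C (π⁻¹ v)) fun x y hxy hx hy =>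
      (hcross x y hxy hx hy).le).2 (by
        have h1 : l (permPoint σ) = l (permPoint π) :=
          le_antisymm (hπs.2 _ (hmem' σ hσ)) (hσs.2 _ (hmem' π hπ))
        rw [hlC, hlC, sum_permPoint_mul π, sum_permPoint_mul π π, mul_inv_cancel] at h1
        exact add_right_cancel h1)
    have hτ : σ * π⁻¹ ≠ 1 := fun h => hne (by rw [mul_inv_eq_one.1 h])
    obtain ⟨x, hx⟩ := exists_lt_apply_of_ne_one hτ
    obtain ⟨y, hy, hy'⟩ := exists_crossing _ x ⟨x, le_rfl, hx⟩
    exact (hcross x y hy' hx (hy.trans_lt hy')).ne (hflow x y x le_rfl hx hy hy')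
  · rintro ⟨a, b, hab, h1, hfix⟩
    dsimp only at h1 hfix
    subst h1
    refine ⟨fun h => ?_, hmem _ hπ, hmem _ hσ, ?_⟩
    · have := permPoint_injective h
      simp [hab.ne] at this
    · rcases swap_mem_not_fixed hπ hab hσ with ⟨h1, h2⟩ | ⟨h1, h2⟩
      · exact isExposed_segment_swap hπ hab hfix h1 h2
      · have h3 := isExposed_segment_swap hσ hab (fun h ha hb => by
          rw [Perm.mul_apply, hfix h ha hb, swap_apply_of_ne_of_ne ha.ne' hb.ne]) h1 h2
        rw [swap_mul_self_mul, segment_symm] at h3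
        exact h3

theorem perm_apply_inv_apply {α : Type*} (π : Perm α) (v : α) : π (π⁻¹ v) = v :=
  π.apply_symm_apply v

/-! ### Inversions -/

/-- The number of inversions of `f`. -/
def invCount {n : ℕ} (f : Fin n → ℕ) : ℕ :=
  ∑ x : Fin n × Fin n, if x.1 < x.2 ∧ f x.2 < f x.1 then 1 else 0

theorem invCount_le {n : ℕ} (f : Fin n → ℕ) : invCount f ≤ n * n := by
  refine (Finset.sum_le_card_nsmul Finset.univ _ 1 fun x _ => ?_).trans (by simp)
  split_ifs <;> simp

theorem invCount_comp_swap {n : ℕ} {f : Fin n → ℕ} {a b : Fin n} (hab : a < b) (hf : f a < f b)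
    (h : ∀ x, a < x → x < b → f x < f a ∨ f b < f x) :
    invCount (f ∘ swap a b) = invCount f + 1 := by
  classical
  let Q : Fin n × Fin n → Prop := fun x => (a ≤ x.1 ∧ x.1 ≤ b) ∧ a ≤ x.2 ∧ x.2 ≤ b
  -- Pairs inside `[a, b]` keep their inversion status, except `(a, b)` itself. For the other pairs,
  -- at least one entry is outside the interval, so relabelling by the swap preserves the order of
  -- positions.
  let φ : Fin n × Fin n → Fin n × Fin n := fun x =>
    if Q x then x else (swap a b x.1, swap a b x.2)
  have hs : ∀ y, (a ≤ swap a b y ∧ swap a b y ≤ b) ↔ a ≤ y ∧ y ≤ b := by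
    intro y
    rw [swap_apply_def]
    split_ifs with h1 h2
    · subst h1; simp [hab.le]
    · subst h2; simp [hab.le]
    · rfl
  have hφ : Function.Involutive φ := by
    intro x
    by_cases hx : Q x
    · simp only [φ, hx, if_true]
    · have hx' : ¬ Q (swap a b x.1, swap a b x.2) := by
        simpa only [Q, hs] using hx
      simp only [φ, hx, hx', if_false, swap_apply_self]
  have hpt : ∀ x : Fin n × Fin n,
      (if x.1 < x.2 ∧ (f ∘ swap a b) x.2 < (f ∘ swap a b) x.1 then 1 else 0) =
      (if (φ x).1 < (φ x).2 ∧ f (φ x).2 < f (φ x).1 then 1 else 0) +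
        if x = (a, b) then 1 else 0 := by
    rintro ⟨x, y⟩
    have hx := h x
    have hy := h y
    have hQ : Q (x, y) ↔ (a ≤ x ∧ x ≤ b) ∧ a ≤ y ∧ y ≤ b := Iff.rfl
    by_cases hxy : Q (x, y)
    · simp only [φ, hxy, if_true, Function.comp_apply, Prod.mk.injEq]
      rw [hQ] at hxy
      simp only [swap_apply_def]
      rcases eq_or_ne x a with rfl | h1 <;> rcases eq_or_ne y b with rfl | h2 <;> grind
    · simp only [φ, hxy, if_false, Function.comp_apply, Prod.mk.injEq]
      rw [hQ] at hxy
      simp only [swap_apply_def]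
      grind
  unfold invCount
  rw [Finset.sum_congr rfl fun x _ => hpt x, Finset.sum_add_distrib,
    Function.Bijective.sum_comp hφ.bijective
      (fun x : Fin n × Fin n => if x.1 < x.2 ∧ f x.2 < f x.1 then 1 else 0)]
  simp

/-! ### The affine permutation attached to a vertex -/

/-- The affinization of `π⁻¹`, for `π ∈ S_{k,n}` with every fixed point in `{1, …, k}` coloured
counterclockwise. -/
def invAffinization {n : ℕ} (k : ℕ) (π : Perm (Fin n)) (v : Fin n) : ℕ :=
  if (π⁻¹ v).1 < k then (π⁻¹ v).1 + n else (π⁻¹ v).1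

theorem invAffinization_injective {n : ℕ} (k : ℕ) (π : Perm (Fin n)) :
    Function.Injective (invAffinization k π) := by
  intro v w h
  apply π⁻¹.injective
  simp only [invAffinization] at h
  ext
  split_ifs at h <;> omega

theorem invAffinization_swap_mul {n : ℕ} (k : ℕ) (π : Perm (Fin n)) (a b : Fin n) :
    invAffinization k (swap a b * π) = invAffinization k π ∘ swap a b := by
  funext v
  simp [invAffinization]

theorem isFixedPos_invAffinization {n k : ℕ} {π : Perm (Fin n)} {v : Fin n} :
    IsFixedPos (invAffinization k π) v ↔ π v = v := by
  have e : π v = v ↔ π⁻¹ v = v := by rw [Perm.inv_eq_iff_eq, eq_comm]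
  rw [e, Fin.ext_iff]
  simp only [IsFixedPos, invAffinization]
  split_ifs <;> omega

theorem invAffinization_bounds {n k : ℕ} {π : Perm (Fin n)}
    (hπ : π ∈ excedancePerms (firstLetters k n)) (v : Fin n) :
    v.1 ≤ invAffinization k π v ∧ invAffinization k π v ≤ v.1 + n := by
  have h1 := hπ.1 (π⁻¹ v)
  have h2 := hπ.2 (π⁻¹ v)
  simp only [firstLetters, Set.mem_ofPred_eq, perm_apply_inv_apply, Fin.le_def] at h1 h2
  simp only [invAffinization]
  split_ifs with h
  · have := h1 h
    omega
  · have := h2 h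
    omega

/-- The bounds after the swap read `b ≤ f a` and `f b ≤ a + n`. A fixed `x` between `a` and `b` has
value `x < f a` or `x + n > f b`, so no intermediate value lies between `f a` and `f b`. -/
theorem invCount_swap_mul {n k : ℕ} {π : Perm (Fin n)} {a b : Fin n}
    (hπ : swap a b * π ∈ excedancePerms (firstLetters k n)) (hab : a < b)
    (hfix : ∀ h, a < h → h < b → π h = h)
    (hlt : invAffinization k π a < invAffinization k π b) :
    invCount (invAffinization k (swap a b * π)) = invCount (invAffinization k π) + 1 := by
  rw [invAffinization_swap_mul]
  refine invCount_comp_swap hab hlt fun x hax hxb => ?_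
  have ha := (invAffinization_bounds hπ b).1
  have hb := (invAffinization_bounds hπ a).2
  simp only [invAffinization_swap_mul, Function.comp_apply, swap_apply_left,
    swap_apply_right] at ha hb
  have hinj := (invAffinization_injective k π).ne hax.ne
  have hinj' := (invAffinization_injective k π).ne hxb.ne
  rcases (isFixedPos_invAffinization (k := k)).2 (hfix x hax hxb) with h | h <;> omega

/-- Membership after the swap gives `b ≤ f a < f b ≤ a + n`, which excludes the values `a`, `a + n`
for `f a` and `b`, `b + n` for `f b`. -/
theorem not_fixed_of_swap_mul_mem {n k : ℕ} {π : Perm (Fin n)} {a b : Fin n}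
    (hs : swap a b * π ∈ excedancePerms (firstLetters k n)) (hab : a < b)
    (hlt : invAffinization k π a < invAffinization k π b) : π a ≠ a ∧ π b ≠ b := by
  have ha := (invAffinization_bounds hs b).1
  have hb := (invAffinization_bounds hs a).2
  simp only [invAffinization_swap_mul, Function.comp_apply, swap_apply_left,
    swap_apply_right] at ha hb
  constructor <;> intro h <;> rcases isFixedPos_invAffinization (k := k).2 h with h | h <;> omega

theorem isBridge_invAffinization_iff {n k : ℕ} {π : Perm (Fin n)}
    (hπ : π ∈ excedancePerms (firstLetters k n)) {a b : Fin n} :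
    IsBridge (invAffinization k π) a b ↔
      a < b ∧ invAffinization k π a < invAffinization k π b ∧
        (∀ h, a < h → h < b → π h = h) ∧
        swap a b * π ∈ excedancePerms (firstLetters k n) := by
  simp only [IsBridge, isFixedPos_invAffinization]
  constructor
  · rintro ⟨h1, h2, h3, h4, h5⟩
    exact ⟨h1, h2, h5, swap_mul_mem hπ h1 h5 (fun h => absurd h h3) fun h => absurd h h4⟩
  · rintro ⟨h1, h2, h5, h6⟩
    obtain ⟨h3, h4⟩ := not_fixed_of_swap_mul_mem h6 h1 h2
    exact ⟨h1, h2, h3, h4, h5⟩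

theorem gt_of_no_bridge {n : ℕ} {f : Fin n → ℕ} (hf : Function.Injective f)
    (hno : ∀ a b, ¬ IsBridge f a b) (a b : Fin n) (hab : a < b) (ha : ¬ IsFixedPos f a)
    (hb : ¬ IsFixedPos f b) : f b < f a := by
  by_cases h : ∀ x, a < x → x < b → IsFixedPos f x
  · by_contra hlt
    exact hno a b ⟨hab, lt_of_le_of_ne (not_lt.1 hlt) (hf.ne hab.ne), ha, hb, h⟩
  · push Not at h
    obtain ⟨x, hax, hxb, hx⟩ := h
    exact (gt_of_no_bridge hf hno x b hxb hx hb).trans (gt_of_no_bridge hf hno a x hax ha hx)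
termination_by b.1 - a.1

/-- Without a bridge, `f` would be strictly decreasing on the non-fixed positions. But the largest
moved value `M` comes from a smaller position, hence from one of the first `k`, so `f M ≥ n`; the
smallest moved value `m` comes from one of the others, so `f m < n`. -/
theorem exists_isBridge {n k : ℕ} {π : Perm (Fin n)}
    (hπ : π ∈ excedancePerms (firstLetters k n)) (h1 : π ≠ 1) :
    ∃ a b, IsBridge (invAffinization k π) a b := by
  classical
  by_contra! hno
  have hgt := gt_of_no_bridge (invAffinization_injective k π) hno
  simp only [isFixedPos_invAffinization] at hgt
  let S : Finset (Fin n) := π.support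
  have hS : S.Nonempty := by
    rw [Finset.nonempty_iff_ne_empty]
    simpa [S] using h1
  have hSinv : ∀ v ∈ S, π⁻¹ v ∈ S := by
    intro v hv
    simp only [S, Perm.mem_support, perm_apply_inv_apply] at hv ⊢
    intro h
    exact hv (Perm.eq_inv_iff_eq.1 h)
  have hne : ∀ v ∈ S, π⁻¹ v ≠ v := by
    intro v hv h
    exact Perm.mem_support.1 hv (Perm.inv_eq_iff_eq.1 h).symm
  have hM := S.max'_mem hS
  have hm := S.min'_mem hS
  set M := S.max' hS
  set m := S.min' hS
  have hM1 : π⁻¹ M < M := lt_of_le_of_ne (S.le_max' _ (hSinv M hM)) (hne M hM)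
  have hm1 : m < π⁻¹ m := lt_of_le_of_ne (S.min'_le _ (hSinv m hm)) (hne m hm).symm
  have hM2 : (π⁻¹ M).1 < k := by
    by_contra hk
    have := hπ.2 (π⁻¹ M) hk
    simp only [perm_apply_inv_apply] at this
    exact absurd this (not_le.2 hM1)
  have hm2 : ¬ (π⁻¹ m).1 < k := by
    intro hk
    have := hπ.1 (π⁻¹ m) hk
    simp only [perm_apply_inv_apply] at this
    exact absurd this (not_le.2 hm1)
  have hlt : invAffinization k π m < invAffinization k π M := by
    simp only [invAffinization, hM2, hm2, if_true, if_false]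
    omega
  have hmM : m < M := lt_of_le_of_ne (S.min'_le _ hM) fun h => by rw [h] at hlt; exact hlt.false
  exact absurd hlt (hgt m M hmM (Perm.mem_support.1 hm) (Perm.mem_support.1 hM)).not_gt

/-! ### Walks in the one-skeleton -/

theorem edgeLabels_cons {n : ℕ} {J : Set (Fin n)} {u v w : excedancePerms J}
    (h : (bridgeGraph J).Adj u v) (p : (bridgeGraph J).Walk v w) :
    edgeLabels (SimpleGraph.Walk.cons h p) = v.1 * u.1⁻¹ :: edgeLabels p := by
  simp [edgeLabels]

theorem edgeLabels_injective {n : ℕ} {J : Set (Fin n)} {u v : excedancePerms J}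
    (p q : (bridgeGraph J).Walk u v) (h : edgeLabels p = edgeLabels q) : p = q := by
  induction p with
  | nil =>
    cases q with
    | nil => rfl
    | cons h' q => simp [edgeLabels] at h
  | @cons u v w h' p ih =>
    cases q with
    | nil => simp [edgeLabels] at h
    | @cons _ v' _ h'' q =>
      rw [edgeLabels_cons, edgeLabels_cons, List.cons.injEq] at h
      obtain rfl : v = v' := Subtype.ext (mul_right_cancel h.1)
      rw [ih q h.2]

/-- The rank of a vertex of `Br_{k,n}`; it changes by one along every edge. -/
def vertexRank {n k : ℕ} (u : excedancePerms (firstLetters k n)) : ℕ :=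
  invCount (invAffinization k u.1)

theorem isBridge_or_vertexRank_of_adj {n k : ℕ} {u v : excedancePerms (firstLetters k n)}
    (h : (bridgeGraph (firstLetters k n)).Adj u v) :
    (∃ a b, IsBridge (invAffinization k u.1) a b ∧ v.1 = swap a b * u.1 ∧
      vertexRank v = vertexRank u + 1) ∨ vertexRank u = vertexRank v + 1 := by
  obtain ⟨a, b, hab, hv, hfix⟩ := (bridgeGraph_adj_iff u v).1 h
  have hs : swap a b * u.1 ∈ excedancePerms (firstLetters k n) := hv ▸ v.2
  rcases lt_or_gt_of_ne ((invAffinization_injective k u.1).ne hab.ne) with hlt | hlt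
  · left
    refine ⟨a, b, (isBridge_invAffinization_iff u.2).2 ⟨hab, hlt, hfix, hs⟩, hv, ?_⟩
    rw [vertexRank, hv]
    exact invCount_swap_mul hs hab hfix hlt
  · right
    have hu : u.1 = swap a b * v.1 := by rw [hv, swap_mul_self_mul]
    rw [vertexRank, hu]
    refine invCount_swap_mul (hu ▸ u.2) hab (fun x hax hxb => ?_) ?_
    · rw [hv, Perm.mul_apply, hfix x hax hxb, swap_apply_of_ne_of_ne hax.ne' hxb.ne]
    · simpa [hv, invAffinization_swap_mul] using hlt

theorem vertexRank_le_add_length {n k : ℕ} {u v : excedancePerms (firstLetters k n)}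
    (p : (bridgeGraph (firstLetters k n)).Walk u v) :
    vertexRank v ≤ vertexRank u + p.length := by
  induction p with
  | nil => simp
  | cons h p ih =>
    rw [SimpleGraph.Walk.length_cons]
    rcases isBridge_or_vertexRank_of_adj h with ⟨_, _, _, _, h1⟩ | h1 <;> omega

/-- Greedy choice of bridges terminates because each raises the rank, which is at most `n * n`. -/
theorem exists_bridgeSequence {n k : ℕ} (u : excedancePerms (firstLetters k n)) :
    ∃ L, BridgeSequence (invAffinization k u.1) L := by
  by_cases h1 : u.1 = 1
  · exact ⟨[], .nil _ fun i => isFixedPos_invAffinization.2 (by rw [h1, Perm.one_apply])⟩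
  · obtain ⟨a, b, hab⟩ := exists_isBridge u.2 h1
    obtain ⟨hlt, h2, hfix, hs⟩ := (isBridge_invAffinization_iff u.2).1 hab
    have hrank : vertexRank (⟨_, hs⟩ : excedancePerms (firstLetters k n)) = vertexRank u + 1 :=
      invCount_swap_mul hs hlt hfix h2
    have hbound : vertexRank (⟨_, hs⟩ : excedancePerms (firstLetters k n)) ≤ n * n :=
      invCount_le _
    obtain ⟨L, hL⟩ := exists_bridgeSequence ⟨_, hs⟩
    rw [invAffinization_swap_mul] at hL
    exact ⟨_, .cons _ a b L hab hL⟩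
termination_by n * n - vertexRank u

theorem exists_walk_of_bridgeSequence {n k : ℕ} {f : Fin n → ℕ} {L : List (Perm (Fin n))}
    (hL : BridgeSequence f L) (u : excedancePerms (firstLetters k n))
    (hf : f = invAffinization k u.1) :
    ∃ p : (bridgeGraph (firstLetters k n)).Walk u (idVertex (firstLetters k n)),
      edgeLabels p = L ∧ vertexRank u + p.length = vertexRank (idVertex (firstLetters k n)) := by
  induction hL generalizing u with
  | nil f hfix =>
    subst hf
    obtain rfl : u = idVertex (firstLetters k n) :=
      Subtype.ext (Equiv.ext fun v => isFixedPos_invAffinization.1 (hfix v))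
    exact ⟨.nil, rfl, rfl⟩
  | cons f a b L hab _ ih =>
    subst hf
    obtain ⟨hlt, h2, hfix, hs⟩ := (isBridge_invAffinization_iff u.2).1 hab
    obtain ⟨p, hp, hlen⟩ := ih ⟨_, hs⟩ (invAffinization_swap_mul k u.1 a b).symm
    have hrank : vertexRank (⟨_, hs⟩ : excedancePerms (firstLetters k n)) = vertexRank u + 1 :=
      invCount_swap_mul hs hlt hfix h2
    refine ⟨.cons ((bridgeGraph_adj_iff u _).2 ⟨a, b, hlt, rfl, hfix⟩) p, ?_, ?_⟩
    · rw [edgeLabels_cons, hp, mul_inv_cancel_right]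
    · rw [SimpleGraph.Walk.length_cons]
      omega

/-- The length equals the rank difference, so a step lowering the rank would leave too few steps to
recover it. -/
theorem bridgeSequence_edgeLabels {n k : ℕ} {u v : excedancePerms (firstLetters k n)}
    (p : (bridgeGraph (firstLetters k n)).Walk u v) (hv : v = idVertex (firstLetters k n))
    (hlen : vertexRank u + p.length = vertexRank v) :
    BridgeSequence (invAffinization k u.1) (edgeLabels p) := by
  induction p with
  | nil =>
    subst hv
    exact .nil _ fun i => isFixedPos_invAffinization.2 rfl
  | @cons u w v h p ih =>
    rw [SimpleGraph.Walk.length_cons] at hlen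
    have hle := vertexRank_le_add_length p
    rcases isBridge_or_vertexRank_of_adj h with ⟨a, b, hab, hw, h1⟩ | h1
    · have hL := ih hv (by omega)
      rw [hw, invAffinization_swap_mul] at hL
      rw [edgeLabels_cons, hw, mul_inv_cancel_right]
      exact .cons _ a b _ hab hL
    · omega

/-- The rank difference bounds every length from below, and a bridge sequence attains the bound. -/
theorem isShortest_iff {n k : ℕ} {u : excedancePerms (firstLetters k n)}
    (p : (bridgeGraph (firstLetters k n)).Walk u (idVertex (firstLetters k n))) :
    IsShortest p ↔
      vertexRank u + p.length = vertexRank (idVertex (firstLetters k n)) := by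
  constructor
  · intro h
    obtain ⟨L, hL⟩ := exists_bridgeSequence u
    obtain ⟨q, -, hq⟩ := exists_walk_of_bridgeSequence hL u rfl
    have h1 := h q
    have h2 := vertexRank_le_add_length p
    omega
  · intro h q
    have := vertexRank_le_add_length q
    omega

/-- The shortest paths from any vertex of `Br_{k,n}` to the identity correspond to the bridge
sequences of the associated affine permutation. -/
theorem bijOn_edgeLabels {n k : ℕ} (u : excedancePerms (firstLetters k n)) :
    Set.BijOn
      (fun p : (bridgeGraph (firstLetters k n)).Walk u (idVertex (firstLetters k n)) =>
        edgeLabels p)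
      {p | IsShortest p} {L | BridgeSequence (invAffinization k u.1) L} := by
  refine ⟨fun p hp => ?_, fun p _ q _ h => edgeLabels_injective p q h, fun L hL => ?_⟩
  · exact bridgeSequence_edgeLabels p rfl ((isShortest_iff p).1 hp)
  · obtain ⟨p, hp, hlen⟩ := exists_walk_of_bridgeSequence hL u rfl
    exact ⟨p, (isShortest_iff p).2 hlen, hp⟩

/-! ### The top vertex -/

theorem bridgeSequence_iff_of_forall_isFixedPos {n : ℕ} {f : Fin n → ℕ}
    (hf : ∀ i, IsFixedPos f i) (L : List (Perm (Fin n))) : BridgeSequence f L ↔ L = [] := by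
  constructor
  · rintro (_ | ⟨_, i, j, L, hij, -⟩)
    · rfl
    · exact absurd (hf i) hij.2.2.1
  · rintro rfl
    exact .nil f hf

theorem bridgeSequence_topDecorated_iff (k n : ℕ) (hk : k ≤ n) (L : List (Perm (Fin n))) :
    BridgeSequence (topDecorated (n - k) n (Nat.sub_le n k)).affinization L ↔
      BridgeSequence (invAffinization k (topPerm k n hk)) L := by
  have hinv : ∀ v : Fin n, ((topPerm k n hk)⁻¹ v).1 = if v.1 < n - k then v.1 + k
      else v.1 - (n - k) := by
    intro v
    change ((topPerm k n hk).invFun v).1 = _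
    simp only [topPerm]
    split_ifs <;> rfl
  have htop : ∀ v : Fin n, (topPerm (n - k) n (Nat.sub_le n k) v).1 =
      if v.1 < n - k then v.1 + k else v.1 - (n - k) := by
    intro v
    change ((topPerm (n - k) n (Nat.sub_le n k)).toFun v).1 = _
    simp only [topPerm]
    split_ifs
    · simp only; omega
    · rfl
  -- For `k = 0` or `k = n` the two functions colour the fixed points oppositely and so differ, but
  -- every position is fixed in both, and only the empty sequence arises.
  by_cases h0 : 0 < k ∧ k < n
  · have : (topDecorated (n - k) n (Nat.sub_le n k)).affinization =
        invAffinization k (topPerm k n hk) := by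
      funext v
      simp only [DecoratedPerm.affinization, topDecorated, invAffinization, Fin.lt_def,
        Fin.ext_iff, hinv, htop]
      split_ifs <;> omega
    rw [this]
  · rw [bridgeSequence_iff_of_forall_isFixedPos, bridgeSequence_iff_of_forall_isFixedPos]
    · intro v
      simp only [IsFixedPos, invAffinization, hinv]
      split_ifs <;> omega
    · intro v
      simp only [IsFixedPos, DecoratedPerm.affinization, topDecorated, Fin.lt_def,
        Fin.ext_iff, htop]
      split_ifs <;> omega

end BridgePolytope

theorem corollary3p3 (k n : ℕ) (hk : k ≤ n) :
    Set.BijOn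
      (fun p : (BridgePolytope.bridgeGraph (BridgePolytope.firstLetters k n)).Walk
          (BridgePolytope.topVertex k n hk)
          (BridgePolytope.idVertex (BridgePolytope.firstLetters k n)) =>
        BridgePolytope.edgeLabels p)
      {p | BridgePolytope.IsShortest p}
      (BridgePolytope.bcfwDecompositions
        (BridgePolytope.topDecorated (n - k) n (Nat.sub_le n k))) := by
  convert BridgePolytope.bijOn_edgeLabels (BridgePolytope.topVertex k n hk) using 1
  ext L
  exact BridgePolytope.bridgeSequence_topDecorated_iff k n hk L
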